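/- Let $E$ be a real vector space of dimension $2$, let $f, g : E \to E$ be linear maps, and let $(t_n)_{n \in \mathbb{N}}$ be a strictly increasing sequence of integers with $t_0 = 1$. Then $$\exp(t_n f + g) = \exp(t_n f) \circ \exp(g) \quad \text{for all } n \in \mathbb{N}$$ if and only if $f \circ g = g \circ f$. Here $\exp(u) = \sum_{j \ge 0} u^j / j!$ is the exponential of a linear endomorphism $u$ of $E$. -/

import Mathlib

/-! Scalar parts factor out of `exp`, so take `f`, `g` to be traceless matrices A, B. Then A² = αI
and B² = βI, and each exponential is a combination of I and the matrix. The traceless part of the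
equation reads xA + yB = zN/2, with N = AB - BA. Suppose N ≠ 0; then A and B are independent. If N
is not nilpotent, then x = y = z = 0, so α, β and t²α + tp + β (with p = tr AB) are all -π² times
squares of integers. An integer quadratic that is a square at arbitrarily large t has zero
discriminant, which makes N nilpotent after all. If N is nilpotent, A and B share an eigenvector,
with eigenvalues a, b, and N/2 = aB - bA. Injectivity of (e^(2x) - 1)/(2x) forces b = -ta for every
t, so a = b = 0 and N = 0. -/

/-- The entire function `z ↦ cosh √z`. -/
noncomputable def coshSqrt (z : ℝ) : ℝ := ∑' n : ℕ, z ^ n / (2 * n).factorial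

/-- The entire function `z ↦ sinh √z / √z`. -/
noncomputable def sinhcSqrt (z : ℝ) : ℝ := ∑' n : ℕ, z ^ n / (2 * n + 1).factorial

/-! ### Identities and zeros of cosh √z and sinh √z / √z -/

theorem summable_pow_div_factorial_of_le (z : ℝ) {k : ℕ → ℕ} (hk : ∀ n, n ≤ k n) :
    Summable fun n : ℕ => z ^ n / (k n).factorial := by
  refine Summable.of_norm_bounded (Real.summable_pow_div_factorial |z|) fun n => ?_
  rw [norm_div, norm_pow, Real.norm_eq_abs, Real.norm_natCast]
  have : (n.factorial : ℝ) ≤ (k n).factorial := by exact_mod_cast Nat.factorial_le (hk n)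
  have : (0 : ℝ) < n.factorial := by exact_mod_cast n.factorial_pos
  gcongr

theorem hasSum_coshSqrt (z : ℝ) : HasSum (fun n : ℕ => z ^ n / (2 * n).factorial) (coshSqrt z) :=
  (summable_pow_div_factorial_of_le z fun n => by omega).hasSum

theorem hasSum_sinhcSqrt (z : ℝ) : HasSum (fun n : ℕ => z ^ n / (2 * n + 1).factorial) (sinhcSqrt z) :=
  (summable_pow_div_factorial_of_le z fun n => by omega).hasSum

theorem coshSqrt_sq (x : ℝ) : coshSqrt (x ^ 2) = Real.cosh x := by
  refine (hasSum_coshSqrt _).unique ?_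
  simpa only [pow_mul] using Real.hasSum_cosh x

theorem mul_sinhcSqrt_sq (x : ℝ) : x * sinhcSqrt (x ^ 2) = Real.sinh x := by
  refine ((hasSum_sinhcSqrt _).mul_left x).unique ?_
  convert! Real.hasSum_sinh x using 2 with n
  ring

theorem coshSqrt_neg_sq (x : ℝ) : coshSqrt (-x ^ 2) = Real.cos x := by
  refine (hasSum_coshSqrt _).unique ?_
  convert! Real.hasSum_cos x using 2 with n
  rw [neg_pow, pow_mul]

theorem mul_sinhcSqrt_neg_sq (x : ℝ) : x * sinhcSqrt (-x ^ 2) = Real.sin x := by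
  refine ((hasSum_sinhcSqrt _).mul_left x).unique ?_
  convert! Real.hasSum_sin x using 2 with n
  rw [neg_pow]
  ring

theorem one_le_sinhcSqrt {z : ℝ} (hz : 0 ≤ z) : 1 ≤ sinhcSqrt z := by
  have := (hasSum_sinhcSqrt z).summable.le_tsum 0 fun n _ => by positivity
  simpa [sinhcSqrt] using this

theorem sinhcSqrt_zero : sinhcSqrt 0 = 1 := by
  rw [sinhcSqrt, tsum_eq_single 0 fun n hn => by simp [hn]]
  simp

theorem coshSqrt_sq_sub (z : ℝ) : coshSqrt z ^ 2 - z * sinhcSqrt z ^ 2 = 1 := by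
  rcases le_total 0 z with h | h
  · obtain ⟨x, rfl⟩ : ∃ x : ℝ, z = x ^ 2 := ⟨√z, (Real.sq_sqrt h).symm⟩
    rw [coshSqrt_sq, ← mul_pow, mul_sinhcSqrt_sq, Real.cosh_sq]
    ring
  · obtain ⟨x, rfl⟩ : ∃ x : ℝ, z = -x ^ 2 :=
      ⟨√(-z), by rw [Real.sq_sqrt (neg_nonneg.2 h), neg_neg]⟩
    rw [coshSqrt_neg_sq, neg_mul, ← mul_pow, mul_sinhcSqrt_neg_sq, sub_neg_eq_add,
      Real.cos_sq_add_sin_sq]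

theorem exists_eq_of_sinhcSqrt_eq_zero {z : ℝ} (h : sinhcSqrt z = 0) :
    ∃ m : ℤ, m ≠ 0 ∧ z = -(m * Real.pi) ^ 2 := by
  have hz : z < 0 := by
    by_contra! hz
    linarith [one_le_sinhcSqrt hz]
  have hx : z = -√(-z) ^ 2 := by rw [Real.sq_sqrt (neg_nonneg.2 hz.le), neg_neg]
  have hsin : Real.sin √(-z) = 0 := by rw [← mul_sinhcSqrt_neg_sq, ← hx, h, mul_zero]
  obtain ⟨m, hm⟩ := Real.sin_eq_zero_iff.1 hsin
  refine ⟨m, ?_, by rw [hm]; exact hx⟩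
  rintro rfl
  rw [← hm] at hx
  norm_num at hx
  exact hz.ne hx

theorem NormedSpace.exp_eq_of_sq_eq_smul_one {𝔸 : Type*} [NormedRing 𝔸] [NormedAlgebra ℝ 𝔸]
    [CompleteSpace 𝔸] {x : 𝔸} {d : ℝ} (h : x ^ 2 = d • (1 : 𝔸)) :
    NormedSpace.exp x = coshSqrt d • (1 : 𝔸) + sinhcSqrt d • x := by
  refine (NormedSpace.exp_series_hasSum_exp' (𝕂 := ℝ) x).unique (HasSum.even_add_odd ?_ ?_)
  · convert! (hasSum_coshSqrt d).smul_const (1 : 𝔸) using 2 with n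
    rw [pow_mul, h, smul_pow, one_pow, smul_smul, div_eq_inv_mul]
  · convert! (hasSum_sinhcSqrt d).smul_const x using 2 with n
    rw [pow_succ, pow_mul, h, smul_pow, one_pow, smul_mul_assoc, one_mul, smul_smul, div_eq_inv_mul]

/-! ### Injectivity of (e^(2x) - 1)/(2x) -/

theorem two_mul_mul_sinhcSqrt_sq_mul_exp (x : ℝ) :
    2 * x * (sinhcSqrt (x ^ 2) * Real.exp x) = Real.exp (2 * x) - 1 := by
  have h : Real.exp x * Real.exp (-x) = 1 := by rw [← Real.exp_add]; simp
  rw [two_mul x, Real.exp_add, ← h]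
  linear_combination 2 * Real.exp x * mul_sinhcSqrt_sq x + 2 * Real.exp x * Real.sinh_eq x

theorem sinhcSqrt_sq_mul_exp_ne_one {x : ℝ} (hx : x ≠ 0) :
    sinhcSqrt (x ^ 2) * Real.exp x ≠ 1 := fun h => by
  have h1 := two_mul_mul_sinhcSqrt_sq_mul_exp x
  have h2 := Real.add_one_lt_exp (mul_ne_zero two_ne_zero hx)
  rw [h] at h1
  linarith

/-- Away from 0 the function is the slope of the secant of `exp` from 0 to 2x, strictly increasing
by strict convexity; the value 1 is attained only at 0. -/
theorem injective_sinhcSqrt_sq_mul_exp :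
    Function.Injective fun x : ℝ => sinhcSqrt (x ^ 2) * Real.exp x := by
  have h0 : sinhcSqrt ((0 : ℝ) ^ 2) * Real.exp 0 = 1 := by simp [sinhcSqrt_zero]
  refine Function.Injective.of_lt_imp_ne fun x y hxy h => ?_
  rcases eq_or_ne x 0 with rfl | hx
  · exact sinhcSqrt_sq_mul_exp_ne_one hxy.ne' (h.symm.trans h0)
  rcases eq_or_ne y 0 with rfl | hy
  · exact sinhcSqrt_sq_mul_exp_ne_one hxy.ne (h.trans h0)
  have key (z : ℝ) (hz : z ≠ 0) :
      sinhcSqrt (z ^ 2) * Real.exp z = (Real.exp (2 * z) - Real.exp 0) / (2 * z - 0) := by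
    rw [Real.exp_zero, ← two_mul_mul_sinhcSqrt_sq_mul_exp, sub_zero]
    field_simp
  refine (strictConvexOn_exp.secant_strict_mono (Set.mem_univ 0) (Set.mem_univ (2 * x))
    (Set.mem_univ (2 * y)) (by simpa) (by simpa) (by linarith)).ne ?_
  rw [← key x hx, ← key y hy]
  exact h

/-! ### Integer quadratics with square values -/

/-- Completing the square, (2ml)² - (2m²t + c)² is constant in t, whereas distinct squares near a
large number differ by more than any constant. -/
theorem four_mul_sq_mul_sq_eq_of_frequently_sq {m k c : ℤ} (hm : m ≠ 0)
    (h : ∀ M : ℤ, ∃ t ≥ M, ∃ l : ℤ, l ^ 2 = m ^ 2 * t ^ 2 + c * t + k ^ 2) :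
    4 * m ^ 2 * k ^ 2 = c ^ 2 := by
  by_contra hne
  obtain ⟨t, ht, l, hl⟩ := h (|4 * m ^ 2 * k ^ 2 - c ^ 2| + |c| + 1)
  have hfac : (2 * m * l) ^ 2 - (2 * m ^ 2 * t + c) ^ 2 = 4 * m ^ 2 * k ^ 2 - c ^ 2 := by
    linear_combination 4 * m ^ 2 * hl
  have hm1 : 1 ≤ m ^ 2 := by have := sq_pos_of_ne_zero hm; omega
  have hc := neg_abs_le c
  have hD := abs_nonneg (4 * m ^ 2 * k ^ 2 - c ^ 2)
  have hY : |4 * m ^ 2 * k ^ 2 - c ^ 2| < 2 * m ^ 2 * t + c := by nlinarith [abs_nonneg c]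
  have hXY : |2 * m * l| ≠ 2 * m ^ 2 * t + c := fun hX => by
    rw [← sq_abs, hX, sub_self] at hfac
    exact hne (by linarith)
  have hX := abs_nonneg (2 * m * l)
  rw [← sq_abs (2 * m * l)] at hfac
  rcases lt_or_gt_of_ne hXY with h1 | h1
  · have := neg_abs_le (4 * m ^ 2 * k ^ 2 - c ^ 2)
    nlinarith
  · have := le_abs_self (4 * m ^ 2 * k ^ 2 - c ^ 2)
    nlinarith

/-! ### Pairs of traceless matrices -/

/-- In the traceless matrices `!![a₁, a₂; a₃, -a₁]` and `!![b₁, b₂; b₃, -b₁]` with nonzero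
commutator, a vanishing linear combination has vanishing coefficients. -/
theorem coeff_eq_zero_of_cross_ne_zero {a₁ a₂ a₃ b₁ b₂ b₃ x y : ℝ}
    (hN : ¬(a₂ * b₃ - a₃ * b₂ = 0 ∧ a₁ * b₂ - a₂ * b₁ = 0 ∧ a₃ * b₁ - a₁ * b₃ = 0))
    (h₁ : x * a₁ + y * b₁ = 0) (h₂ : x * a₂ + y * b₂ = 0) (h₃ : x * a₃ + y * b₃ = 0) :
    x = 0 ∧ y = 0 := by
  constructor <;> by_contra hx <;> refine hN ⟨?_, ?_, ?_⟩ <;> apply mul_left_cancel₀ hx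
  · linear_combination b₃ * h₂ - b₂ * h₃
  · linear_combination b₂ * h₁ - b₁ * h₂
  · linear_combination b₁ * h₃ - b₃ * h₁
  · linear_combination a₂ * h₃ - a₃ * h₂
  · linear_combination a₁ * h₂ - a₂ * h₁
  · linear_combination a₃ * h₁ - a₁ * h₃

/-- If the commutator of two traceless matrices is nonzero and nilpotent, then it is a
combination of the two matrices, with coefficients their eigenvalues on its kernel. -/
theorem exists_eigenvalues_of_cross_isotropic {a₁ a₂ a₃ b₁ b₂ b₃ : ℝ}
    (hN : ¬(a₂ * b₃ - a₃ * b₂ = 0 ∧ a₁ * b₂ - a₂ * b₁ = 0 ∧ a₃ * b₁ - a₁ * b₃ = 0))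
    (h : (a₂ * b₃ - a₃ * b₂) ^ 2 + 4 * (a₁ * b₂ - a₂ * b₁) * (a₃ * b₁ - a₁ * b₃) = 0) :
    ∃ a b : ℝ, a₁ ^ 2 + a₂ * a₃ = a ^ 2 ∧ b₁ ^ 2 + b₂ * b₃ = b ^ 2 ∧
      2 * a₁ * b₁ + a₂ * b₃ + a₃ * b₂ = 2 * a * b ∧
      a₂ * b₃ - a₃ * b₂ = 2 * (a * b₁ - b * a₁) ∧
      a₁ * b₂ - a₂ * b₁ = a * b₂ - b * a₂ ∧ a₃ * b₁ - a₁ * b₃ = a * b₃ - b * a₃ := by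
  by_cases h₂ : a₁ * b₂ - a₂ * b₁ = 0
  · have h₁ : a₂ * b₃ - a₃ * b₂ = 0 := by
      rw [h₂] at h
      simpa using h
    have h₃ : a₃ * b₁ - a₁ * b₃ ≠ 0 := fun h₃ => hN ⟨h₁, h₂, h₃⟩
    have ha : a₂ = 0 := by
      apply mul_left_cancel₀ h₃
      linear_combination -a₃ * h₂ - a₁ * h₁
    have hb : b₂ = 0 := by
      apply mul_left_cancel₀ h₃
      linear_combination -b₃ * h₂ - b₁ * h₁
    subst ha hb
    -- Here the kernel of the commutator is spanned by (0, 1).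
    exact ⟨-a₁, -b₁, by ring, by ring, by ring, by ring, by ring, by ring⟩
  · obtain ⟨k, hk⟩ : ∃ k, a₂ * b₃ - a₃ * b₂ = 2 * k * (a₁ * b₂ - a₂ * b₁) :=
      ⟨(a₂ * b₃ - a₃ * b₂) / (a₁ * b₂ - a₂ * b₁) / 2, by
        rw [mul_div_cancel₀ _ two_ne_zero, div_mul_cancel₀ _ h₂]⟩
    have h₃ : a₃ * b₁ - a₁ * b₃ = -k ^ 2 * (a₁ * b₂ - a₂ * b₁) := by
      apply mul_left_cancel₀ h₂
      rw [hk] at h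
      linear_combination h / 4
    have ha : a₃ + 2 * a₁ * k - a₂ * k ^ 2 = 0 := by
      apply mul_left_cancel₀ h₂
      linear_combination -a₁ * hk - a₂ * h₃
    have hb : b₃ + 2 * b₁ * k - b₂ * k ^ 2 = 0 := by
      apply mul_left_cancel₀ h₂
      linear_combination -b₁ * hk - b₂ * h₃
    -- The kernel is spanned by (1, -k); `ha` and `hb` say that it is a common eigenvector.
    refine ⟨a₁ - a₂ * k, b₁ - b₂ * k, ?_, ?_, ?_, ?_, ?_, ?_⟩
    · linear_combination a₂ * ha
    · linear_combination b₂ * hb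
    · linear_combination a₂ * hb + b₂ * ha
    · linear_combination hk
    · ring
    · linear_combination 2 * h₃ + k * hk

/-! ### The traceless case -/

theorem commute_of_coshSqrt_eq {a₁ a₂ a₃ b₁ b₂ b₃ : ℝ} {t : ℕ → ℤ} (ht : StrictMono t)
    (ht0 : t 0 = 1)
    (h : ∀ n, coshSqrt (-((t n : ℝ) • !![a₁, a₂; a₃, -a₁] + !![b₁, b₂; b₃, -b₁]).det) •
          (1 : Matrix (Fin 2) (Fin 2) ℝ) +
        sinhcSqrt (-((t n : ℝ) • !![a₁, a₂; a₃, -a₁] + !![b₁, b₂; b₃, -b₁]).det) •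
          ((t n : ℝ) • !![a₁, a₂; a₃, -a₁] + !![b₁, b₂; b₃, -b₁]) =
      (coshSqrt (-((t n : ℝ) • !![a₁, a₂; a₃, -a₁]).det) • (1 : Matrix (Fin 2) (Fin 2) ℝ) +
          sinhcSqrt (-((t n : ℝ) • !![a₁, a₂; a₃, -a₁]).det) •
            ((t n : ℝ) • !![a₁, a₂; a₃, -a₁])) *
        (coshSqrt (-!![b₁, b₂; b₃, -b₁].det) • (1 : Matrix (Fin 2) (Fin 2) ℝ) +
          sinhcSqrt (-!![b₁, b₂; b₃, -b₁].det) • !![b₁, b₂; b₃, -b₁])) :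
    a₂ * b₃ - a₃ * b₂ = 0 ∧ a₁ * b₂ - a₂ * b₁ = 0 ∧ a₃ * b₁ - a₁ * b₃ = 0 := by
  by_contra hN
  set α := a₁ ^ 2 + a₂ * a₃ with hα
  set β := b₁ ^ 2 + b₂ * b₃ with hβ
  set p := 2 * a₁ * b₁ + a₂ * b₃ + a₃ * b₂ with hp
  set c₂ := coshSqrt β
  set s₂ := sinhcSqrt β
  have hdetB : -!![b₁, b₂; b₃, -b₁].det = β := by
    rw [Matrix.det_fin_two_of]; ring
  -- Traceless part of the equation, entry by entry.
  have hent (n : ℕ) : ∃ x y z : ℝ,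
      x = sinhcSqrt ((t n : ℝ) ^ 2 * α + t n * p + β) * t n - sinhcSqrt (t n ^ 2 * α) * t n * c₂ ∧
      y = sinhcSqrt ((t n : ℝ) ^ 2 * α + t n * p + β) - coshSqrt (t n ^ 2 * α) * s₂ ∧
      z = sinhcSqrt ((t n : ℝ) ^ 2 * α) * s₂ * t n ∧
      x * a₁ + y * b₁ = z * (a₂ * b₃ - a₃ * b₂) / 2 ∧
      x * a₂ + y * b₂ = z * (a₁ * b₂ - a₂ * b₁) ∧
      x * a₃ + y * b₃ = z * (a₃ * b₁ - a₁ * b₃) := by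
    have hd : -((t n : ℝ) • !![a₁, a₂; a₃, -a₁] + !![b₁, b₂; b₃, -b₁]).det =
        (t n : ℝ) ^ 2 * α + t n * p + β := by
      rw [Matrix.det_fin_two]
      simp
      ring
    have he : -((t n : ℝ) • !![a₁, a₂; a₃, -a₁]).det = (t n : ℝ) ^ 2 * α := by
      rw [Matrix.det_fin_two]
      simp
      ring
    have hde := h n
    rw [hdetB, hd, he] at hde
    refine ⟨_, _, _, rfl, rfl, rfl, ?_⟩
    have h00 := congrFun₂ hde 0 0
    have h01 := congrFun₂ hde 0 1
    have h10 := congrFun₂ hde 1 0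
    have h11 := congrFun₂ hde 1 1
    simp [Matrix.mul_apply, Fin.sum_univ_two] at h00 h01 h10 h11
    refine ⟨?_, ?_, ?_⟩
    · linear_combination h00 / 2 - h11 / 2
    · linear_combination h01
    · linear_combination h10
  have hle (n : ℕ) : (n : ℤ) ≤ t n := by
    induction n with
    | zero => simp [ht0]
    | succ n ih =>
      have := ht (Nat.lt_add_one n)
      push_cast
      omega
  have htpos (n : ℕ) : (t n : ℝ) ≠ 0 := by
    have := ht.monotone n.zero_le
    have : t n ≠ 0 := by omega
    exact_mod_cast this
  by_cases hν : (a₂ * b₃ - a₃ * b₂) ^ 2 + 4 * (a₁ * b₂ - a₂ * b₁) * (a₃ * b₁ - a₁ * b₃) = 0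
  · obtain ⟨a, b, ha, hb, hab, h₁, h₂, h₃⟩ := exists_eigenvalues_of_cross_isotropic hN hν
    have hba (n : ℕ) : b = -(t n * a) := by
      obtain ⟨x, y, z, hx, hy, hz, e₁, e₂, e₃⟩ := hent n
      obtain ⟨hxb, hya⟩ := coeff_eq_zero_of_cross_ne_zero (x := x + z * b) (y := y - z * a) hN
        (by linear_combination e₁ + z * h₁ / 2) (by linear_combination e₂ + z * h₂)
        (by linear_combination e₃ + z * h₃)
      have hd : (t n : ℝ) ^ 2 * α + t n * p + β = (t n * a + b) ^ 2 := by
        rw [hα, hβ, hp, ha, hb, hab]; ring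
      have he : (t n : ℝ) ^ 2 * α = (t n * a) ^ 2 := by rw [hα, ha]; ring
      have hcb : c₂ = Real.cosh b := by rw [← coshSqrt_sq, ← hb]
      have hsb : b * s₂ = Real.sinh b := by rw [← mul_sinhcSqrt_sq, ← hb]
      have hca := coshSqrt_sq (t n * a)
      have hsa := mul_sinhcSqrt_sq (t n * a)
      rw [hd, he] at hx hy
      rw [he] at hz
      have E₁ : sinhcSqrt ((t n * a + b) ^ 2) = s₂ * Real.exp (t n * a) := by
        rw [← Real.cosh_add_sinh]
        linear_combination hya - hy + a * hz + s₂ * hca + s₂ * hsa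
      have E₂ : sinhcSqrt ((t n * a + b) ^ 2) = sinhcSqrt ((t n * a) ^ 2) * Real.exp (-b) := by
        rw [← Real.cosh_sub_sinh]
        apply mul_left_cancel₀ (htpos n)
        linear_combination hxb - hx - b * hz + sinhcSqrt ((t n * a) ^ 2) * t n * (hcb - hsb)
      refine injective_sinhcSqrt_sq_mul_exp (?_ :
        sinhcSqrt (b ^ 2) * Real.exp b = sinhcSqrt ((-(t n * a)) ^ 2) * Real.exp (-(t n * a)))
      have E₃ : s₂ * Real.exp (t n * a) = sinhcSqrt ((t n * a) ^ 2) * Real.exp (-b) :=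
        E₁.symm.trans E₂
      rw [← hb, neg_sq]
      have i₁ : Real.exp (t n * a) * Real.exp (-(t n * a)) = 1 := by rw [← Real.exp_add]; simp
      have i₂ : Real.exp b * Real.exp (-b) = 1 := by rw [← Real.exp_add]; simp
      linear_combination Real.exp b * Real.exp (-(t n * a)) * E₃ - s₂ * Real.exp b * i₁ +
        sinhcSqrt ((t n * a) ^ 2) * Real.exp (-(t n * a)) * i₂
    have ha0 : a = 0 := by
      have ht01 : t 0 < t 1 := ht zero_lt_one
      have hne : (t 1 : ℝ) - t 0 ≠ 0 := by
        rw [sub_ne_zero]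
        exact_mod_cast ht01.ne'
      apply mul_left_cancel₀ hne
      linear_combination hba 1 - hba 0
    have hb0 : b = 0 := by rw [hba 0, ha0, mul_zero, neg_zero]
    rw [ha0, hb0] at h₁ h₂ h₃
    exact hN ⟨by simpa using h₁, by simpa using h₂, by simpa using h₃⟩
  · have hcoef (n : ℕ) : sinhcSqrt ((t n : ℝ) ^ 2 * α + t n * p + β) =
          sinhcSqrt ((t n : ℝ) ^ 2 * α) * c₂ ∧
        sinhcSqrt ((t n : ℝ) ^ 2 * α + t n * p + β) = coshSqrt ((t n : ℝ) ^ 2 * α) * s₂ ∧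
        sinhcSqrt ((t n : ℝ) ^ 2 * α) * s₂ = 0 := by
      obtain ⟨x, y, z, hx, hy, hz, e₁, e₂, e₃⟩ := hent n
      -- Pair with N under the trace form: N is orthogonal to A and B, but not to itself.
      have hz0 : z = 0 := by
        apply mul_left_cancel₀ hν
        linear_combination -2 * (a₂ * b₃ - a₃ * b₂) * e₁ - 2 * (a₃ * b₁ - a₁ * b₃) * e₂ -
          2 * (a₁ * b₂ - a₂ * b₁) * e₃
      obtain ⟨hx0, hy0⟩ := coeff_eq_zero_of_cross_ne_zero (x := x) (y := y) hN
        (by rw [e₁, hz0]; ring) (by rw [e₂, hz0]; ring) (by rw [e₃, hz0]; ring)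
      refine ⟨?_, by linarith, ?_⟩
      · apply mul_left_cancel₀ (htpos n)
        linear_combination hx0 - hx
      · apply mul_left_cancel₀ (htpos n)
        linear_combination hz0 - hz
    have hs₂ : s₂ = 0 := by
      by_contra hs
      obtain ⟨k₁, k₂, k₃⟩ := hcoef 0
      have hs₁ := (mul_eq_zero.1 k₃).resolve_right hs
      have hsq := coshSqrt_sq_sub ((t 0 : ℝ) ^ 2 * α)
      rw [k₁, hs₁, zero_mul, eq_comm, mul_eq_zero, or_iff_left hs] at k₂
      rw [k₂, hs₁] at hsq
      norm_num at hsq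
    have hc₂ : c₂ ≠ 0 := fun hc => by
      have hsq : c₂ ^ 2 - β * s₂ ^ 2 = 1 := coshSqrt_sq_sub β
      rw [hc, hs₂] at hsq
      norm_num at hsq
    have hd0 (n : ℕ) : sinhcSqrt ((t n : ℝ) ^ 2 * α + t n * p + β) = 0 := by
      rw [(hcoef n).2.1, hs₂, mul_zero]
    have hα0 : sinhcSqrt α = 0 := by
      have := (hcoef 0).1
      rw [hd0, ht0] at this
      simpa [hc₂] using this
    obtain ⟨m, hm, hmα⟩ := exists_eq_of_sinhcSqrt_eq_zero hα0
    obtain ⟨k, -, hkβ⟩ := exists_eq_of_sinhcSqrt_eq_zero hs₂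
    choose l _ hl using fun n => exists_eq_of_sinhcSqrt_eq_zero (hd0 n)
    have hpi : Real.pi ^ 2 ≠ 0 := by positivity
    have hpc : p = -((l 0 ^ 2 - m ^ 2 - k ^ 2 : ℤ) * Real.pi ^ 2) := by
      have := hl 0
      rw [ht0, hmα, hkβ] at this
      push_cast at this ⊢
      linear_combination this
    have hsq := four_mul_sq_mul_sq_eq_of_frequently_sq (k := k) (c := l 0 ^ 2 - m ^ 2 - k ^ 2) hm
      fun M => by
        obtain ⟨n, hn⟩ : ∃ n, M ≤ t n := ⟨M.toNat, (Int.self_le_toNat M).trans (hle _)⟩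
        refine ⟨t n, hn, l n, ?_⟩
        have := hl n
        rw [hmα, hpc, hkβ] at this
        have : (l n : ℝ) ^ 2 = m ^ 2 * t n ^ 2 + (l 0 ^ 2 - m ^ 2 - k ^ 2 : ℤ) * t n + k ^ 2 := by
          apply mul_left_cancel₀ hpi
          linear_combination this
        exact_mod_cast this
    -- The quantity in `hν` equals p² - 4αβ.
    refine hν ?_
    have hsqR : (4 * m ^ 2 * k ^ 2 : ℝ) = ((l 0 ^ 2 - m ^ 2 - k ^ 2 : ℤ) : ℝ) ^ 2 := by
      exact_mod_cast hsq
    have : p ^ 2 = 4 * α * β := by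
      rw [hpc, hmα, hkβ]
      linear_combination -Real.pi ^ 4 * hsqR
    linear_combination this

/-! ### Reduction to traceless matrices -/

theorem NormedSpace.exp_smul_one_add {𝔸 : Type*} [NormedRing 𝔸] [NormedAlgebra ℝ 𝔸]
    [CompleteSpace 𝔸] (c : ℝ) (x : 𝔸) :
    NormedSpace.exp (c • (1 : 𝔸) + x) = Real.exp c • NormedSpace.exp x := by
  let : NormedAlgebra ℚ 𝔸 := NormedAlgebra.restrictScalars ℚ ℝ 𝔸
  rw [NormedSpace.exp_add_of_commute ((Commute.one_left x).smul_left c),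
    ← Algebra.algebraMap_eq_smul_one, ← NormedSpace.algebraMap_exp_comm, ← Real.exp_eq_exp_ℝ,
    ← Algebra.smul_def]

/-- By Cayley–Hamilton x² is scalar, so `exp x` has a closed form in `𝔸`; `φ` then passes through it
by linearity, with no continuity or matrix norm needed. -/
theorem NormedSpace.exp_eq_of_trace_eq_zero {𝔸 : Type*} [NormedRing 𝔸] [NormedAlgebra ℝ 𝔸]
    [CompleteSpace 𝔸] {φ : 𝔸 →ₐ[ℝ] Matrix (Fin 2) (Fin 2) ℝ} (hφ : Function.Injective φ) {x : 𝔸}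
    (hx : (φ x).trace = 0) :
    φ (NormedSpace.exp x) = coshSqrt (-(φ x).det) • (1 : Matrix (Fin 2) (Fin 2) ℝ) +
      sinhcSqrt (-(φ x).det) • φ x := by
  have hsq : x ^ 2 = (-(φ x).det) • (1 : 𝔸) := by
    apply hφ
    rw [Matrix.trace_fin_two] at hx
    rw [map_pow, map_smul, map_one, Matrix.det_fin_two, pow_two]
    ext i j
    fin_cases i <;> fin_cases j <;> simp [Matrix.mul_apply, Fin.sum_univ_two]
    · linear_combination φ x 0 0 * hx
    · linear_combination φ x 0 1 * hx
    · linear_combination φ x 1 0 * hx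
    · linear_combination φ x 1 1 * hx
  rw [NormedSpace.exp_eq_of_sq_eq_smul_one hsq, map_add, map_smul, map_smul, map_one]

theorem mul_comm_of_exp_add_eq {𝔸 : Type*} [NormedRing 𝔸] [NormedAlgebra ℝ 𝔸]
    [CompleteSpace 𝔸] {φ : 𝔸 →ₐ[ℝ] Matrix (Fin 2) (Fin 2) ℝ} (hφ : Function.Injective φ)
    {t : ℕ → ℤ} (ht : StrictMono t) (ht0 : t 0 = 1) {f g : 𝔸}
    (h : ∀ n, NormedSpace.exp ((t n : ℝ) • f + g) =
      NormedSpace.exp ((t n : ℝ) • f) * NormedSpace.exp g) :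
    f * g = g * f := by
  have hdecomp (x : 𝔸) : ∃ (c : ℝ) (y : 𝔸), (φ y).trace = 0 ∧ x = c • (1 : 𝔸) + y :=
    ⟨(φ x).trace / 2, x - ((φ x).trace / 2) • (1 : 𝔸), by simp, by abel⟩
  obtain ⟨c, x, hx, rfl⟩ := hdecomp f
  obtain ⟨d, y, hy, rfl⟩ := hdecomp g
  have hform {z : 𝔸} (hz : (φ z).trace = 0) :
      φ z = !![φ z 0 0, φ z 0 1; φ z 1 0, -φ z 0 0] := by
    rw [Matrix.trace_fin_two] at hz
    rw [← eq_neg_of_add_eq_zero_right hz]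
    exact Matrix.eta_fin_two _
  have hexp (n : ℕ) : NormedSpace.exp ((t n : ℝ) • x + y) =
      NormedSpace.exp ((t n : ℝ) • x) * NormedSpace.exp y := by
    have hn := h n
    rw [show (t n : ℝ) • (c • (1 : 𝔸) + x) + (d • (1 : 𝔸) + y) =
        (t n * c + d) • (1 : 𝔸) + ((t n : ℝ) • x + y) by module, smul_add, smul_smul,
      NormedSpace.exp_smul_one_add, NormedSpace.exp_smul_one_add, NormedSpace.exp_smul_one_add,
      smul_mul_smul_comm, ← Real.exp_add] at hn
    exact smul_right_injective 𝔸 (Real.exp_ne_zero _) hn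
  have hmat (n : ℕ) := congrArg φ (hexp n)
  have htx (n : ℕ) : (φ ((t n : ℝ) • x)).trace = 0 := by
    rw [map_smul, Matrix.trace_smul, hx, smul_zero]
  have htxy (n : ℕ) : (φ ((t n : ℝ) • x + y)).trace = 0 := by
    rw [map_add, Matrix.trace_add, htx, hy, add_zero]
  simp only [map_mul, NormedSpace.exp_eq_of_trace_eq_zero hφ (htxy _),
    NormedSpace.exp_eq_of_trace_eq_zero hφ (htx _),
    NormedSpace.exp_eq_of_trace_eq_zero hφ hy, map_add, map_smul] at hmat
  have hx' := hform hx
  have hy' := hform hy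
  rw [hx', hy'] at hmat
  obtain ⟨h₁, h₂, h₃⟩ := commute_of_coshSqrt_eq ht ht0 hmat
  have hxy : x * y = y * x := by
    apply hφ
    rw [map_mul, map_mul, hx', hy', Matrix.mul_fin_two, Matrix.mul_fin_two]
    rw [Matrix.of.injective.eq_iff, Matrix.vecCons_inj, Matrix.vecCons_inj, Matrix.vecCons_inj,
      Matrix.vecCons_inj, Matrix.vecCons_inj, Matrix.vecCons_inj]
    refine ⟨⟨?_, ?_, Subsingleton.elim _ _⟩, ⟨?_, ?_, Subsingleton.elim _ _⟩,
      Subsingleton.elim _ _⟩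
    · linear_combination h₁
    · linear_combination 2 * h₂
    · linear_combination 2 * h₃
    · linear_combination -h₁
  have hone (r : ℝ) (z : 𝔸) : Commute (r • (1 : 𝔸)) z := (Commute.one_left z).smul_left r
  exact (hone c _).add_left ((hone d x).symm.add_right hxy)

theorem theorem1 {E : Type*} [NormedAddCommGroup E] [NormedSpace ℝ E]
    (hE : Module.finrank ℝ E = 2) (f g : E →L[ℝ] E)
    (t : ℕ → ℤ) (ht : StrictMono t) (ht0 : t 0 = 1) :
    (∀ n : ℕ, NormedSpace.exp ((t n : ℝ) • f + g) =
        (NormedSpace.exp ((t n : ℝ) • f)).comp (NormedSpace.exp g)) ↔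
      f.comp g = g.comp f := by
  have : FiniteDimensional ℝ E := .of_finrank_eq_succ hE
  have : CompleteSpace E := FiniteDimensional.complete ℝ E
  constructor
  · intro h
    let b := Module.finBasisOfFinrankEq ℝ E hE
    let φ : (E →L[ℝ] E) →ₐ[ℝ] Matrix (Fin 2) (Fin 2) ℝ :=
      AlgHom.ofLinearMap
        ((LinearMap.toMatrixAlgEquiv b).toLinearMap ∘ₗ ContinuousLinearMap.coeLM ℝ)
        (map_one (LinearMap.toMatrixAlgEquiv b))
        fun x y => map_mul (LinearMap.toMatrixAlgEquiv b) (x : E →ₗ[ℝ] E) y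
    have hφ : Function.Injective φ :=
      (LinearMap.toMatrixAlgEquiv b).injective.comp ContinuousLinearMap.coe_injective
    exact mul_comm_of_exp_add_eq hφ ht ht0 h
  · intro h n
    let : NormedAlgebra ℚ (E →L[ℝ] E) := NormedAlgebra.restrictScalars ℚ ℝ (E →L[ℝ] E)
    have hfg : Commute f g := h
    exact NormedSpace.exp_add_of_commute (hfg.smul_left _)
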